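/- Let $m>3$. Let $G$ be a directed graph on the vertex set $\{1,\dots,m\}$ (commodities), without loops or multiple edges, in which there is a directed path from every vertex to every other vertex. Let $b=(b_{ij})$ be a matrix with $b_{ij}>0$ if $ij$ is an edge of $G$ and $b_{ij}=0$ otherwise (the aggregate offers of commodity $i$ for commodity $j$). There is a vector $p=p(b)$ with strictly positive entries, unique up to a positive scalar, such that $$\sum_i p_i b_{ij}=\sum_i p_j b_{ji}\qquad\text{for all } j .$$ The $G$-mechanism $M_G$ has $p(b)$ as prices in the state $b$, and returns to an individual who offers $a=(a_{ij})\ge 0$ on the edges of $G$ the amount $r_j(a,b)=\sum_i (p_i/p_j)a_{ij}$ of each commodity $j$. Let $\mathfrak M(m)$ be the set of all mechanisms $M_G$, where two mechanisms are identified if one is obtained from the other by relabeling the commodities. For $M=M_G$ let the time complexity $\tau(M)=\max_{i\ne j}\tau_{ij}(M)$ be the diameter of $G$, where $\tau_{ij}(M)$ is the length of a shortest directed path from $i$ to $j$. Call a component $b_{kl}$ ($kl$ an edge of $G$) influential for a function of $b$ if the function takes different values at two states $b,b'$ that differ only in that component. Let $\pi_{ij}(M)$ be the number of influential components of $b$ for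 the price ratio $p_i/p_j$, and let the price complexity be $\pi(M)=\max_{i\neq j}\pi_{ij}(M)$. Write $M\preceq M'$ if $\tau(M)\le\tau(M')$ and $\pi(M)\le\pi(M')$. A mechanism $M\in\mathfrak M(m)$ is $\preceq$-minimal if there is no $M'\in\mathfrak M(m)$ with $M'\preceq M$ and with strict inequality for at least one of $\tau,\pi$. The star, cycle and complete mechanisms are the mechanisms $M_G$ for the graphs $G$ with edge sets $\{mi,\,im : i<m\}$, $\{12,23,\dots,m1\}$ and $\{ij : i\ne j\}$ respectively. **Theorem.** The $\preceq$-minimal elements of $\mathfrak M(m)$ are precisely the star, the cycle and the complete mechanism, and these three are distinct (even up to relabeling). Their complexities $(\pi,\tau)$ are $(4,2)$, $(2,m-1)$ and $(m(m-1),1)$ respectively. -/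

import Mathlib

/-- A directed simple graph on the commodity set `Fin m` (no loops) which is connected: from every
vertex there is a directed path to every other vertex. An edge `i j` is the opportunity to offer
commodity `i` in exchange for commodity `j`. -/
structure TradeGraph (m : ℕ) extends Digraph (Fin m) where
  loopless : ∀ i, ¬ Adj i i
  connected : ∀ i j, i ≠ j → Relation.TransGen Adj i j

namespace TradeGraph

/-- The offers an individual can make: nonnegative weights on the edges, zero off the edges. -/
def Offer {m : ℕ} (G : TradeGraph m) : Type :=
  {a : Fin m → Fin m → ℝ // ∀ i j, 0 ≤ a i j ∧ (¬ G.Adj i j → a i j = 0)}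

/-- The aggregate offers (market states): strictly positive weights on the edges, zero off the
edges. -/
def Aggregate {m : ℕ} (G : TradeGraph m) : Type :=
  {b : Fin m → Fin m → ℝ // ∀ i j, (G.Adj i j → 0 < b i j) ∧ (¬ G.Adj i j → b i j = 0)}

/-- `p` is a strictly positive price vector for which value is conserved in the state `b`: for each
commodity `j`, the value of all offers for `j` equals the value of all offers of `j`. -/
def IsPrice {m : ℕ} {G : TradeGraph m} (b : G.Aggregate) (p : Fin m → ℝ) : Prop :=
  (∀ i, 0 < p i) ∧ ∀ j, ∑ i, p i * b.1 i j = ∑ i, p j * b.1 j i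

theorem Aggregate.nonneg {m : ℕ} {G : TradeGraph m} (b : G.Aggregate) (i j : Fin m) :
    0 ≤ b.1 i j := by
  by_cases h : G.Adj i j
  · exact ((b.2 i j).1 h).le
  · exact ((b.2 i j).2 h).ge

/-- A nonnegative solution of the value conservation equations that vanishes somewhere vanishes
everywhere. -/
theorem eq_zero_of_conserve {m : ℕ} {G : TradeGraph m} (b : G.Aggregate) (q : Fin m → ℝ)
    (hq : ∀ i, 0 ≤ q i) (hc : ∀ j, ∑ i, q i * b.1 i j = ∑ i, q j * b.1 j i)
    (j : Fin m) (hj : q j = 0) (i : Fin m) : q i = 0 := by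
  have step : ∀ u v, G.Adj u v → q v = 0 → q u = 0 := by
    intro u v huv hv
    have h := hc v
    simp only [hv, zero_mul, Finset.sum_const_zero] at h
    have h0 := (Finset.sum_eq_zero_iff_of_nonneg
      (fun w _ => mul_nonneg (hq w) (b.nonneg w v))).1 h u (Finset.mem_univ u)
    exact (mul_eq_zero.1 h0).resolve_right ((b.2 u v).1 huv).ne'
  by_cases hij : i = j
  · rw [hij, hj]
  · have ht := G.connected i j hij
    clear hij
    induction ht using Relation.TransGen.head_induction_on with
    | single h => exact step _ _ h hj
    | head h _ ih => exact step _ _ h ih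

/-- Prices exist. -/
theorem exists_isPrice {m : ℕ} {G : TradeGraph m} (b : G.Aggregate) : ∃ p, IsPrice b p := by
  classical
  rcases Nat.eq_zero_or_pos m with rfl | hm
  · exact ⟨fun _ => 1, fun i => i.elim0, fun i => i.elim0⟩
  let L : Matrix (Fin m) (Fin m) ℝ :=
    Matrix.of fun i j => b.1 i j - if i = j then ∑ k, b.1 i k else 0
  have hdet : L.det = 0 := by
    apply Matrix.exists_mulVec_eq_zero_iff.1
    refine ⟨fun _ => 1, ?_, ?_⟩
    · intro h
      exact one_ne_zero (congrFun h ⟨0, hm⟩)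
    · funext i
      simp [L, Matrix.mulVec, dotProduct, Finset.sum_sub_distrib]
  obtain ⟨v, hv0, hv⟩ := Matrix.exists_vecMul_eq_zero_iff.2 hdet
  have hvc : ∀ j, ∑ i, v i * b.1 i j = ∑ i, v j * b.1 j i := by
    intro j
    have h := congrFun hv j
    simp only [L, Matrix.vecMul, dotProduct, Matrix.of_apply, mul_sub, Finset.sum_sub_distrib,
      Pi.zero_apply, mul_ite, mul_zero, Finset.sum_ite_eq', Finset.mem_univ, if_true] at h
    rw [← Finset.mul_sum]
    linarith
  have hle : ∀ j ∈ Finset.univ, ∑ i, |v j| * b.1 j i ≤ ∑ i, |v i| * b.1 i j := by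
    intro j _
    calc ∑ i, |v j| * b.1 j i = |∑ i, v j * b.1 j i| := by
          rw [← Finset.mul_sum, ← Finset.mul_sum, abs_mul,
            abs_of_nonneg (Finset.sum_nonneg fun i _ => b.nonneg j i)]
      _ = |∑ i, v i * b.1 i j| := by rw [hvc j]
      _ ≤ ∑ i, |v i * b.1 i j| := Finset.abs_sum_le_sum_abs _ _
      _ = ∑ i, |v i| * b.1 i j := by
          refine Finset.sum_congr rfl fun i _ => ?_
          rw [abs_mul, abs_of_nonneg (b.nonneg i j)]
  have hc : ∀ j, ∑ i, |v i| * b.1 i j = ∑ i, |v j| * b.1 j i := by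
    have h := (Finset.sum_eq_sum_iff_of_le hle).1 Finset.sum_comm
    exact fun j => (h j (Finset.mem_univ j)).symm
  refine ⟨fun i => |v i|, fun i => ?_, hc⟩
  refine lt_of_le_of_ne (abs_nonneg _) fun h => hv0 ?_
  funext k
  exact abs_eq_zero.1 (eq_zero_of_conserve b (fun i => |v i|) (fun i => abs_nonneg _) hc i h.symm k)

/-- Prices are unique up to a positive scalar. -/
theorem IsPrice.unique {m : ℕ} {G : TradeGraph m} {b : G.Aggregate} {p q : Fin m → ℝ}
    (hp : IsPrice b p) (hq : IsPrice b q) : ∃ c : ℝ, 0 < c ∧ ∀ i, p i = c * q i := by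
  rcases Nat.eq_zero_or_pos m with rfl | hm
  · exact ⟨1, one_pos, fun i => i.elim0⟩
  have : Nonempty (Fin m) := ⟨⟨0, hm⟩⟩
  obtain ⟨k, hk⟩ := Finite.exists_min fun i => p i / q i
  refine ⟨p k / q k, div_pos (hp.1 k) (hq.1 k), fun i => ?_⟩
  have h := eq_zero_of_conserve b (fun i => p i - p k / q k * q i) (fun i => ?_) (fun j => ?_) k
    (by field_simp [(hq.1 k).ne']; ring) i
  · linarith
  · have := (le_div_iff₀ (hq.1 i)).1 (hk i)
    linarith
  · simp only [sub_mul, Finset.sum_sub_distrib, mul_assoc, ← Finset.mul_sum]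
    have h1 := hp.2 j
    have h2 := hq.2 j
    rw [← Finset.mul_sum] at h1 h2
    rw [h1, h2]

/-- A representative of the unique ray of prices in the state `b`. -/
noncomputable def price {m : ℕ} (G : TradeGraph m) (b : G.Aggregate) : Fin m → ℝ :=
  Classical.choose (exists_isPrice b)

theorem price_isPrice {m : ℕ} (G : TradeGraph m) (b : G.Aggregate) : IsPrice b (G.price b) :=
  Classical.choose_spec (exists_isPrice b)

/-- The price ratios do not depend on the representative. -/
theorem price_div_price {m : ℕ} (G : TradeGraph m) (b : G.Aggregate) {p : Fin m → ℝ}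
    (hp : IsPrice b p) (i j : Fin m) : G.price b i / G.price b j = p i / p j := by
  obtain ⟨c, hc, h⟩ := (G.price_isPrice b).unique hp
  rw [h i, h j, mul_div_mul_left _ _ hc.ne']

end TradeGraph

/-- A trading mechanism: its graph of opportunities, the price ratios `p i / p j` as functions of
the market state, and the returns to an individual as a function of his own offer and the market
state. Only the mechanisms `TradeGraph.mechanism G` below are considered. -/
structure Mechanism (m : ℕ) where
  graph : TradeGraph m
  priceRatio : Fin m → Fin m → graph.Aggregate → ℝ
  ret : graph.Offer → graph.Aggregate → Fin m → ℝ

/-- The `G`-mechanism. -/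
noncomputable def TradeGraph.mechanism {m : ℕ} (G : TradeGraph m) : Mechanism m where
  graph := G
  priceRatio i j b := G.price b i / G.price b j
  ret a b j := ∑ i, G.price b i / G.price b j * a.1 i j

/-- The class of all `G`-mechanisms on `m` commodities. -/
def gMechanisms (m : ℕ) : Set (Mechanism m) :=
  Set.range TradeGraph.mechanism

namespace Mechanism

/-- `M` and `N` differ only by a relabeling of the commodities. -/
def IsRelabeling {m : ℕ} (M N : Mechanism m) : Prop :=
  ∃ σ : Equiv.Perm (Fin m),
    (∀ i j, N.graph.Adj (σ i) (σ j) ↔ M.graph.Adj i j) ∧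
    ∀ (b : M.graph.Aggregate) (b' : N.graph.Aggregate), (∀ i j, b'.1 (σ i) (σ j) = b.1 i j) →
      (∀ i j, N.priceRatio (σ i) (σ j) b' = M.priceRatio i j b) ∧
      ∀ (a : M.graph.Offer) (a' : N.graph.Offer), (∀ i j, a'.1 (σ i) (σ j) = a.1 i j) →
        ∀ j, N.ret a' b' (σ j) = M.ret a b j

/-- The number of time periods needed to exchange `i` for `j`: the least length `k` of a sequence
of consecutive edges from `i` to `j`. -/
noncomputable def timeComplexityAt {m : ℕ} (M : Mechanism m) (i j : Fin m) : ℕ :=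
  sInf {k | ∃ v : ℕ → Fin m, v 0 = i ∧ v k = j ∧ ∀ t < k, M.graph.Adj (v t) (v (t + 1))}

/-- The time complexity `τ`. -/
noncomputable def timeComplexity {m : ℕ} (M : Mechanism m) : ℕ :=
  (Finset.univ : Finset (Fin m)).offDiag.sup fun e => M.timeComplexityAt e.1 e.2

/-- The component `b k l` of the market state is influential for `f` if `f` takes different values
at two states that differ only in that component. (A component off the edges is constantly zero,
so it is never influential.) -/
def Influential {m : ℕ} {G : TradeGraph m} (f : G.Aggregate → ℝ) (k l : Fin m) : Prop :=
  ∃ b b' : G.Aggregate, (∀ u v, (u, v) ≠ (k, l) → b.1 u v = b'.1 u v) ∧ f b ≠ f b'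

/-- The number of influential components in the price ratio `p i / p j`. -/
noncomputable def priceComplexityAt {m : ℕ} (M : Mechanism m) (i j : Fin m) : ℕ :=
  {e : Fin m × Fin m | Influential (M.priceRatio i j) e.1 e.2}.ncard

/-- The price complexity `π`. -/
noncomputable def priceComplexity {m : ℕ} (M : Mechanism m) : ℕ :=
  (Finset.univ : Finset (Fin m)).offDiag.sup fun e => M.priceComplexityAt e.1 e.2

/-- The quasiorder `M ⪯ N`. -/
def Preceq {m : ℕ} (M N : Mechanism m) : Prop :=
  M.timeComplexity ≤ N.timeComplexity ∧ M.priceComplexity ≤ N.priceComplexity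

/-- `M` is a minimal element of the class of `G`-mechanisms: no `G`-mechanism is at least as good
in both complexities and strictly better in at least one. -/
def IsMinimal {m : ℕ} (M : Mechanism m) : Prop :=
  M ∈ gMechanisms m ∧
    ¬ ∃ N ∈ gMechanisms m, N.Preceq M ∧
      (N.timeComplexity < M.timeComplexity ∨ N.priceComplexity < M.priceComplexity)

end Mechanism

/-- The star graph with center `c`: all edges `i c` and `c i` with `i ≠ c`. -/
def TradeGraph.star {m : ℕ} (c : Fin m) : TradeGraph m where
  Adj i j := i ≠ j ∧ (i = c ∨ j = c)
  loopless _ h := h.1 rfl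
  connected i j hij := by
    by_cases hi : i = c
    · exact .single ⟨hij, Or.inl hi⟩
    by_cases hj : j = c
    · exact .single ⟨hij, Or.inr hj⟩
    exact .head ⟨hi, Or.inr rfl⟩ (.single ⟨fun h => hj h.symm, Or.inl rfl⟩)

/-- The cycle graph, with the edges `0 1`, `1 2`, …, `(m - 1) 0`. -/
def TradeGraph.cycle (m : ℕ) : TradeGraph m where
  Adj i j := i ≠ j ∧ (i.val + 1) % m = j.val
  loopless _ h := h.1 rfl
  connected i j hij := by
    have key : ∀ (k : ℕ) (j : Fin m), (i.val + k) % m = j.val →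
        Relation.ReflTransGen
          (fun i j : Fin m => i ≠ j ∧ (i.val + 1) % m = j.val) i j := by
      intro k
      induction k with
      | zero =>
        intro j h
        have hij : i = j := by
          apply Fin.ext
          rw [← h, Nat.add_zero, Nat.mod_eq_of_lt i.isLt]
        rw [hij]
      | succ k ih =>
        intro j h
        have hm : 0 < m := lt_of_le_of_lt (Nat.zero_le _) i.isLt
        have h1 := ih ⟨(i.val + k) % m, Nat.mod_lt _ hm⟩ rfl
        by_cases hne : (⟨(i.val + k) % m, Nat.mod_lt _ hm⟩ : Fin m) = j
        · rwa [hne] at h1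
        · refine h1.tail ⟨hne, ?_⟩
          simp only [Nat.mod_add_mod]
          exact h
    have h := key (m - i.val + j.val) j (by
      have hi := i.isLt
      have : i.val + (m - i.val + j.val) = j.val + m := by omega
      rw [this, Nat.add_mod_right, Nat.mod_eq_of_lt j.isLt])
    exact (Relation.reflTransGen_iff_eq_or_transGen.1 h).resolve_left (fun e => hij e.symm)

/-- The complete graph: all edges `i j` with `i ≠ j`. -/
def TradeGraph.complete (m : ℕ) : TradeGraph m where
  Adj i j := i ≠ j
  loopless _ h := h rfl
  connected _ _ hij := .single hij

/-- The star mechanism; its center (the money) is the last of the `m` commodities. -/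
noncomputable def starMechanism (m : ℕ) (hm : 0 < m) : Mechanism m :=
  (TradeGraph.star (⟨m - 1, Nat.sub_one_lt hm.ne'⟩ : Fin m)).mechanism

/-- The cycle mechanism. -/
noncomputable def cycleMechanism (m : ℕ) : Mechanism m :=
  (TradeGraph.cycle m).mechanism

/-- The complete mechanism. -/
noncomputable def completeMechanism (m : ℕ) : Mechanism m :=
  (TradeGraph.complete m).mechanism

/-!
The proof rests on two facts about how the prices react when the offer on one edge `k l` grows.
If `p` and `p'` are the prices before and after, the ratio `y = p' / p` is harmonic, with respect to
the positive weights `p u * b u v` on in-neighbours, at every vertex except `k` and `l`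
(`sum_mul_ratio_sub`). By the maximum principle `y` is least at `k` and greatest at `l`; the minimum
is not shared by a vertex that `l` reaches without passing `k`, and the maximum is not shared by
another out-neighbour of `k`. Since `p i / p j` changes exactly when `y i ≠ y j`, this gives two
supplies of influential edges:

* an edge out of `i` from whose end `j` can be reached without returning to `i` influences
  `p i / p j` and `p j / p i` (`influential_out`);
* if `k` has distinct out-neighbours `l` and `l'`, then both edges influence `p l / p l'`
  (`influential_fork`).

Applied to the out-neighbours `l`, `l'` of a vertex of out-degree at least two, they yield four
influential edges (`four_le_priceComplexity`): the edges from `k` to `l` and `l'`, one edge out of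
`l` and one out of `l'`. So a price complexity below four forces all out-degrees to be one, and a
connected graph with this property is a cycle (`exists_perm_cycle`). If the price complexity is at
most four, there is no fifth influential edge for `p l / p l'`. Hence `l` and `l'` have no second
common in-neighbour, and only one edge out of `l` leads to `l'` without returning to `l`. Together
with the assumption that all distances are at most two, this forces a star when `m > 3`
(`exists_center`). Finally, time complexity one means that the graph is complete.

Both complexities are invariant under relabeling, and those of the star and the cycle are bounded
above by their explicit price formulas, so the classification of the minimal mechanisms follows by
comparing numbers (`isMinimal_iff_iso`).
-/

namespace TradeGraph

variable {m : ℕ} {G : TradeGraph m}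

/-! ### Potential theory for a perturbed state -/

/-- The state `b` with the offers on the edge `k l` increased by one unit. -/
def Aggregate.bump (b : G.Aggregate) {k l : Fin m} (h : G.Adj k l) : G.Aggregate :=
  ⟨fun u v => b.1 u v + if u = k ∧ v = l then 1 else 0, fun u v => by
    by_cases huv : u = k ∧ v = l
    · obtain ⟨rfl, rfl⟩ := huv
      have := (b.2 u v).1 h
      exact ⟨fun _ => by simp only [and_self, if_true]; linarith, fun h' => absurd h h'⟩
    · simpa only [huv, if_false, add_zero] using b.2 u v⟩

theorem Aggregate.bump_apply (b : G.Aggregate) {k l : Fin m} (h : G.Adj k l) (u v : Fin m) :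
    (b.bump h).1 u v = b.1 u v + if u = k ∧ v = l then 1 else 0 := rfl

/-- For the ratio `y = p' / p` of the prices after and before an increase of `b k l`, the weighted
Laplacian of `y`, taken over in-neighbours, is positive at `k`, negative at `l` and zero
elsewhere. -/
theorem sum_mul_ratio_sub {b : G.Aggregate} {k l : Fin m} {h : G.Adj k l} {p p' : Fin m → ℝ}
    (hp : IsPrice b p) (hp' : IsPrice (b.bump h) p') (v : Fin m) :
    ∑ u, p u * b.1 u v * (p' u / p u - p' v / p v)
      = (if v = k then p' k else 0) - if v = l then p' k else 0 := by
  have e1 : ∑ u, p u * b.1 u v * (p' u / p u - p' v / p v)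
      = ∑ u, p' u * b.1 u v - ∑ u, p' v * b.1 v u := by
    have : ∀ u, p u * b.1 u v * (p' u / p u - p' v / p v)
        = p' u * b.1 u v - p' v / p v * (p u * b.1 u v) := by
      intro u
      have := (hp.1 u).ne'
      field_simp
    simp only [this, Finset.sum_sub_distrib]
    rw [← Finset.mul_sum, hp.2 v, Finset.mul_sum]
    congr 1
    refine Finset.sum_congr rfl fun u _ => ?_
    have := (hp.1 v).ne'
    field_simp
  have e2 := hp'.2 v
  simp only [Aggregate.bump_apply, mul_add, Finset.sum_add_distrib, ite_and, mul_ite, mul_one,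
    mul_zero] at e2
  have e3 : ∑ u, (if u = k then if v = l then p' u else 0 else 0) = if v = l then p' k else 0 := by
    simp
  have e4 : ∑ u, (if v = k then if u = l then p' v else 0 else 0) = if v = k then p' k else 0 := by
    by_cases hv : v = k
    · simp [hv]
    · simp [hv]
  rw [e3, e4] at e2
  rw [e1]
  linarith

/-- Minimum principle: away from `k`, a minimum of the price ratio propagates to the in-neighbours,
and it cannot occur at `l`. -/
theorem ratio_eq_of_min {b : G.Aggregate} {k l : Fin m} {h : G.Adj k l} {p p' : Fin m → ℝ}
    (hp : IsPrice b p) (hp' : IsPrice (b.bump h) p') {v : Fin m} (hv : v ≠ k)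
    (hmin : ∀ u, p' v / p v ≤ p' u / p u) :
    v ≠ l ∧ ∀ u, G.Adj u v → p' u / p u = p' v / p v := by
  have e := sum_mul_ratio_sub hp hp' v
  have hnn : ∀ u ∈ Finset.univ, 0 ≤ p u * b.1 u v * (p' u / p u - p' v / p v) := fun u _ =>
    mul_nonneg (mul_nonneg (hp.1 u).le (b.nonneg u v)) (sub_nonneg.2 (hmin u))
  have hs := Finset.sum_nonneg hnn
  rw [if_neg hv] at e
  have hl : v ≠ l := by
    intro hl
    rw [if_pos hl] at e
    linarith [hp'.1 k]
  refine ⟨hl, fun u hu => ?_⟩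
  rw [if_neg hl, sub_zero] at e
  have h0 := (Finset.sum_eq_zero_iff_of_nonneg hnn).1 e u (Finset.mem_univ u)
  have := (mul_eq_zero.1 h0).resolve_left (mul_pos (hp.1 u) ((b.2 u v).1 hu)).ne'
  linarith

/-- Maximum principle: away from `l`, a maximum of the price ratio propagates to the in-neighbours,
and it cannot occur at `k`. -/
theorem ratio_eq_of_max {b : G.Aggregate} {k l : Fin m} {h : G.Adj k l} {p p' : Fin m → ℝ}
    (hp : IsPrice b p) (hp' : IsPrice (b.bump h) p') {v : Fin m} (hv : v ≠ l)
    (hmax : ∀ u, p' u / p u ≤ p' v / p v) :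
    v ≠ k ∧ ∀ u, G.Adj u v → p' u / p u = p' v / p v := by
  have e := sum_mul_ratio_sub hp hp' v
  have hnp : ∀ u ∈ Finset.univ, p u * b.1 u v * (p' u / p u - p' v / p v) ≤ 0 := fun u _ =>
    mul_nonpos_of_nonneg_of_nonpos (mul_nonneg (hp.1 u).le (b.nonneg u v)) (sub_nonpos.2 (hmax u))
  have hs := Finset.sum_nonpos hnp
  rw [if_neg hv] at e
  have hk : v ≠ k := by
    intro hk
    rw [if_pos hk] at e
    linarith [hp'.1 k]
  refine ⟨hk, fun u hu => ?_⟩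
  rw [if_neg hk, sub_zero] at e
  have h0 := (Finset.sum_eq_zero_iff_of_nonpos hnp).1 e u (Finset.mem_univ u)
  have := (mul_eq_zero.1 h0).resolve_left (mul_pos (hp.1 u) ((b.2 u v).1 hu)).ne'
  linarith

theorem ratio_source_le {b : G.Aggregate} {k l : Fin m} {h : G.Adj k l} {p p' : Fin m → ℝ}
    (hp : IsPrice b p) (hp' : IsPrice (b.bump h) p') (v : Fin m) :
    p' k / p k ≤ p' v / p v := by
  have : Nonempty (Fin m) := ⟨v⟩
  obtain ⟨w, hw⟩ := Finite.exists_min fun i => p' i / p i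
  suffices hk : p' k / p k = p' w / p w by rw [hk]; exact hw v
  by_cases hkw : k = w
  · rw [hkw]
  have ht := G.connected k w hkw
  clear hkw
  induction ht with
  | single hs =>
    exact (ratio_eq_of_min hp hp' (fun e => G.loopless k (by rwa [e] at hs)) hw).2 _ hs
  | @tail x y _ hxy ih =>
    by_cases hy : y = k
    · rw [hy]
    have e := (ratio_eq_of_min hp hp' hy hw).2 x hxy
    rw [← e]
    exact ih (by rw [e]; exact hw)

theorem ratio_le_target {b : G.Aggregate} {k l : Fin m} {h : G.Adj k l} {p p' : Fin m → ℝ}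
    (hp : IsPrice b p) (hp' : IsPrice (b.bump h) p') (v : Fin m) :
    p' v / p v ≤ p' l / p l := by
  have : Nonempty (Fin m) := ⟨v⟩
  obtain ⟨w, hw⟩ := Finite.exists_max fun i => p' i / p i
  suffices hl : p' l / p l = p' w / p w by rw [hl]; exact hw v
  by_cases hlw : l = w
  · rw [hlw]
  have ht := G.connected l w hlw
  clear hlw
  induction ht with
  | single hs =>
    exact (ratio_eq_of_max hp hp' (fun e => G.loopless l (by rwa [e] at hs)) hw).2 _ hs
  | @tail x y _ hxy ih =>
    by_cases hy : y = l
    · rw [hy]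
    have e := (ratio_eq_of_max hp hp' hy hw).2 x hxy
    rw [← e]
    exact ih (by rw [e]; exact hw)

/-- `G.ReachAvoid i u v`: there is a directed path from `u` to `v` which does not enter `i`. -/
def ReachAvoid (G : TradeGraph m) (i u v : Fin m) : Prop :=
  Relation.ReflTransGen (fun x y => G.Adj x y ∧ y ≠ i) u v

theorem ratio_source_lt {b : G.Aggregate} {k l : Fin m} {h : G.Adj k l} {p p' : Fin m → ℝ}
    (hp : IsPrice b p) (hp' : IsPrice (b.bump h) p') {j : Fin m} (hj : G.ReachAvoid k l j) :
    p' k / p k < p' j / p j := by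
  have hle := ratio_source_le hp hp'
  refine lt_of_le_of_ne (hle j) ?_
  induction hj with
  | refl =>
    intro e
    exact (ratio_eq_of_min hp hp' (fun e => G.loopless k (by rwa [e] at h))
      (by rw [← e]; exact hle)).1 rfl
  | tail _ hs ih =>
    intro e
    refine ih ?_
    rw [(ratio_eq_of_min hp hp' hs.2 (by rw [← e]; exact hle)).2 _ hs.1, e]

theorem ratio_lt_target {b : G.Aggregate} {k l : Fin m} {h : G.Adj k l} {p p' : Fin m → ℝ}
    (hp : IsPrice b p) (hp' : IsPrice (b.bump h) p') {j : Fin m} (hkj : G.Adj k j) (hj : j ≠ l) :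
    p' j / p j < p' l / p l := by
  have hle := ratio_le_target hp hp'
  refine lt_of_le_of_ne (hle j) fun e => ?_
  have e1 := (ratio_eq_of_max hp hp' hj (by rw [e]; exact hle)).2 k hkj
  exact (ratio_eq_of_max hp hp' (v := k) (fun e => G.loopless k (by rwa [← e] at h))
    (by rw [e1, e]; exact hle)).1 rfl

/-! ### Influential edges -/

theorem influential_of_ratio_ne {b : G.Aggregate} {k l : Fin m} (h : G.Adj k l)
    {p p' : Fin m → ℝ} (hp : IsPrice b p) (hp' : IsPrice (b.bump h) p') {i j : Fin m}
    (hne : p' i / p i ≠ p' j / p j) :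
    Mechanism.Influential (G.mechanism.priceRatio i j) k l := by
  refine ⟨b, b.bump h, fun u v huv => ?_, ?_⟩
  · rw [Aggregate.bump_apply, if_neg (fun e => huv (Prod.ext e.1 e.2)), add_zero]
  · change G.price b i / G.price b j ≠ G.price (b.bump h) i / G.price (b.bump h) j
    rw [G.price_div_price b hp, G.price_div_price _ hp']
    intro e
    apply hne
    have h1 := hp.1 i
    have h2 := hp.1 j
    have h3 := hp'.1 j
    field_simp at e ⊢
    linarith

/-- The state in which every edge carries one unit. -/
noncomputable def unitState (G : TradeGraph m) : G.Aggregate := by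
  classical
  exact ⟨fun u v => if G.Adj u v then 1 else 0, fun u v => ⟨fun h => by simp [h], fun h => by
    simp [h]⟩⟩

/-- An edge out of `i` from whose end `j` can be reached without returning to `i` influences the
price ratios of `i` and `j`. -/
theorem influential_out {i j l : Fin m} (h : G.Adj i l) (hj : G.ReachAvoid i l j) :
    Mechanism.Influential (G.mechanism.priceRatio i j) i l ∧
      Mechanism.Influential (G.mechanism.priceRatio j i) i l := by
  have hp := G.price_isPrice G.unitState
  have hp' := G.price_isPrice (G.unitState.bump h)
  have hlt := ratio_source_lt hp hp' hj
  exact ⟨influential_of_ratio_ne h hp hp' hlt.ne, influential_of_ratio_ne h hp hp' hlt.ne'⟩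

/-- If `k` has two out-neighbours `l`, `j`, then the edge `k l` influences their price ratios. -/
theorem influential_fork {k l j : Fin m} (h : G.Adj k l) (hkj : G.Adj k j) (hj : j ≠ l) :
    Mechanism.Influential (G.mechanism.priceRatio l j) k l ∧
      Mechanism.Influential (G.mechanism.priceRatio j l) k l := by
  have hp := G.price_isPrice G.unitState
  have hp' := G.price_isPrice (G.unitState.bump h)
  have hlt := ratio_lt_target hp hp' hkj hj
  exact ⟨influential_of_ratio_ne h hp hp' hlt.ne', influential_of_ratio_ne h hp hp' hlt.ne⟩

theorem exists_adj_reachAvoid {i j : Fin m} (hij : i ≠ j) :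
    ∃ z, G.Adj i z ∧ G.ReachAvoid i z j := by
  have ht := G.connected i j hij
  induction ht with
  | single h => exact ⟨_, h, .refl⟩
  | @tail x y _ hxy ih =>
    by_cases hx : i = x
    · subst hx
      exact ⟨y, hxy, .refl⟩
    · obtain ⟨z, hz, hr⟩ := ih hx
      exact ⟨z, hz, hr.tail ⟨hxy, hij.symm⟩⟩

theorem adj_of_influential {i j k l : Fin m}
    (h : Mechanism.Influential (G.mechanism.priceRatio i j) k l) : G.Adj k l := by
  obtain ⟨b, b', hb, hne⟩ := h
  by_contra hkl
  refine hne (congrArg _ (Subtype.ext ?_))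
  funext u v
  by_cases huv : (u, v) = (k, l)
  · obtain ⟨rfl, rfl⟩ := Prod.ext_iff.1 huv
    rw [(b.2 _ _).2 hkl, (b'.2 _ _).2 hkl]
  · exact hb u v huv

/-! ### Lower bounds for the price complexity -/

theorem card_le_priceComplexity (G : TradeGraph m) {i j : Fin m} (hij : i ≠ j)
    (s : Finset (Fin m × Fin m))
    (hs : ∀ e ∈ s, Mechanism.Influential (G.mechanism.priceRatio i j) e.1 e.2) :
    s.card ≤ G.mechanism.priceComplexity := by
  have h1 : s.card ≤ G.mechanism.priceComplexityAt i j := by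
    rw [← Set.ncard_coe_finset]
    exact Set.ncard_le_ncard (fun e he => hs e he) (Set.toFinite _)
  exact h1.trans (Finset.le_sup (f := fun e : Fin m × Fin m =>
    G.mechanism.priceComplexityAt e.1 e.2) (by simpa using hij : (i, j) ∈ Finset.univ.offDiag))

theorem adj_ne {i j : Fin m} (h : G.Adj i j) : i ≠ j := by
  rintro rfl
  exact G.loopless _ h

theorem two_le_priceComplexity {i j : Fin m} (hij : i ≠ j) : 2 ≤ G.mechanism.priceComplexity := by
  obtain ⟨z, hz, hr⟩ := G.exists_adj_reachAvoid hij
  obtain ⟨z', hz', hr'⟩ := G.exists_adj_reachAvoid hij.symm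
  refine le_trans (le_of_eq ?_) (G.card_le_priceComplexity hij {(i, z), (j, z')} ?_)
  · simp [hij]
  · simpa using ⟨(influential_out hz hr).1, (influential_out hz' hr').2⟩

theorem four_le_priceComplexity {k l l' : Fin m} (h : G.Adj k l) (h' : G.Adj k l') (hl : l ≠ l') :
    4 ≤ G.mechanism.priceComplexity := by
  obtain ⟨z, hz, hr⟩ := G.exists_adj_reachAvoid hl
  obtain ⟨z', hz', hr'⟩ := G.exists_adj_reachAvoid hl.symm
  have := adj_ne h
  have := adj_ne h'
  refine le_trans (le_of_eq ?_)
    (G.card_le_priceComplexity hl {(k, l), (k, l'), (l, z), (l', z')} ?_)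
  · rw [Finset.card_insert_of_notMem, Finset.card_insert_of_notMem, Finset.card_pair] <;>
      simp [*]
  · simpa using ⟨(influential_fork h h' hl.symm).1, (influential_fork h' h hl).2,
      (influential_out hz hr).1, (influential_out hz' hr').2⟩

/-- If no price ratio has more than four influential components, then two commodities have at most
one common in-neighbour. -/
theorem eq_of_common_inNeighbors (hG : G.mechanism.priceComplexity ≤ 4) {k k' l l' : Fin m}
    (hl : l ≠ l') (h1 : G.Adj k l) (h2 : G.Adj k l') (h3 : G.Adj k' l) (h4 : G.Adj k' l') :
    k = k' := by
  by_contra hk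
  obtain ⟨z, hz, hr⟩ := G.exists_adj_reachAvoid hl
  have := adj_ne h1
  have := adj_ne h3
  have hc := G.card_le_priceComplexity hl {(k, l), (k, l'), (k', l), (k', l'), (l, z)} (by
    simpa using ⟨(influential_fork h1 h2 hl.symm).1, (influential_fork h2 h1 hl).2,
      (influential_fork h3 h4 hl.symm).1, (influential_fork h4 h3 hl).2,
      (influential_out hz hr).1⟩)
  rw [Finset.card_insert_of_notMem, Finset.card_insert_of_notMem, Finset.card_insert_of_notMem,
    Finset.card_pair] at hc <;> simp [*] at hc ⊢
  omega

/-- If no price ratio has more than four influential components and `l`, `l'` have a common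
in-neighbour, then only one edge out of `l` leads to `l'` without returning to `l`. -/
theorem eq_of_reachAvoid (hG : G.mechanism.priceComplexity ≤ 4) {k l l' x x' : Fin m}
    (hl : l ≠ l') (h1 : G.Adj k l) (h2 : G.Adj k l') (hx : G.Adj l x) (hx' : G.Adj l x')
    (hr : G.ReachAvoid l x l') (hr' : G.ReachAvoid l x' l') : x = x' := by
  by_contra hne
  obtain ⟨z, hz, hrz⟩ := G.exists_adj_reachAvoid hl.symm
  have := adj_ne h1
  have := adj_ne h2
  have hc := G.card_le_priceComplexity hl {(k, l), (k, l'), (l, x), (l, x'), (l', z)} (by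
    simpa using ⟨(influential_fork h1 h2 hl.symm).1, (influential_fork h2 h1 hl).2,
      (influential_out hx hr).1, (influential_out hx' hr').1, (influential_out hz hrz).2⟩)
  rw [Finset.card_insert_of_notMem, Finset.card_insert_of_notMem, Finset.card_insert_of_notMem,
    Finset.card_pair] at hc <;> simp [*] at hc ⊢
  omega

/-! ### Graphs of small complexity -/

theorem exists_adj (G : TradeGraph m) (hm : 1 < m) (i : Fin m) : ∃ j, G.Adj i j := by
  have : Nontrivial (Fin m) := Fin.nontrivial_iff_two_le.2 hm
  obtain ⟨j, hj⟩ := exists_ne i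
  obtain ⟨z, hz, -⟩ := G.exists_adj_reachAvoid hj.symm
  exact ⟨z, hz⟩

/-- A connected graph in which no vertex has two out-neighbours is a cycle. -/
theorem exists_perm_cycle (G : TradeGraph m) (hm : 1 < m)
    (h : ∀ k l l', G.Adj k l → G.Adj k l' → l = l') :
    ∃ σ : Equiv.Perm (Fin m), ∀ i j, (cycle m).Adj (σ i) (σ j) ↔ G.Adj i j := by
  choose f hf using G.exists_adj hm
  have hadj : ∀ i j, G.Adj i j ↔ f i = j := fun i j =>
    ⟨fun hij => h i _ _ (hf i) hij, fun e => e ▸ hf i⟩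
  have hreach : ∀ i j, Relation.TransGen G.Adj i j → ∃ n, 0 < n ∧ f^[n] i = j := by
    intro i j ht
    induction ht with
    | single hs => exact ⟨1, one_pos, (hadj _ _).1 hs⟩
    | tail _ hs ih =>
      obtain ⟨n, -, hn⟩ := ih
      exact ⟨n + 1, n.succ_pos, by rw [Function.iterate_succ_apply', hn, (hadj _ _).1 hs]⟩
  let a : Fin m := ⟨0, by omega⟩
  obtain ⟨n₀, hn₀, hper⟩ := hreach a a
    (.head (hf a) (G.connected _ _ (adj_ne (hf a)).symm))
  have hd : 0 < Function.minimalPeriod f a :=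
    Function.IsPeriodicPt.minimalPeriod_pos hn₀ hper
  have hsurj : ∀ v, ∃ n < Function.minimalPeriod f a, f^[n] a = v := by
    intro v
    have : ∃ n, f^[n] a = v := by
      by_cases hv : a = v
      · exact ⟨0, hv⟩
      · obtain ⟨n, -, hn⟩ := hreach a v (G.connected a v hv)
        exact ⟨n, hn⟩
    obtain ⟨n, hn⟩ := this
    exact ⟨n % _, Nat.mod_lt _ hd, by rw [Function.iterate_mod_minimalPeriod_eq, hn]⟩
  have hbij : Function.Bijective fun n : Fin (Function.minimalPeriod f a) => f^[n.1] a := by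
    constructor
    · intro x y hxy
      exact Fin.ext (Function.iterate_injOn_Iio_minimalPeriod x.2 y.2 hxy)
    · intro v
      obtain ⟨n, hn, e⟩ := hsurj v
      exact ⟨⟨n, hn⟩, e⟩
  have hdm : Function.minimalPeriod f a = m := by
    simpa using Fintype.card_of_bijective hbij
  have hbij' : Function.Bijective fun n : Fin m => f^[n.1] a := by
    rw [← Finite.surjective_iff_bijective]
    intro v
    obtain ⟨n, hn, e⟩ := hsurj v
    exact ⟨⟨n, by omega⟩, e⟩
  let g := Equiv.ofBijective _ hbij'
  have hg : ∀ n : Fin m, g n = f^[n.1] a := fun _ => rfl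
  refine ⟨g.symm, fun i j => ?_⟩
  obtain ⟨x, rfl⟩ := g.surjective i
  obtain ⟨y, rfl⟩ := g.surjective j
  rw [g.symm_apply_apply, g.symm_apply_apply, hadj, hg x, ← Function.iterate_succ_apply' f x.1 a,
    ← Function.iterate_mod_minimalPeriod_eq, hdm]
  have hlt : (x.1 + 1) % m < m := Nat.mod_lt _ (by omega)
  change x ≠ y ∧ (x.1 + 1) % m = y.1 ↔ g ⟨(x.1 + 1) % m, hlt⟩ = g y
  rw [g.injective.eq_iff, Fin.ext_iff]
  refine ⟨fun e => e.2, fun e => ⟨?_, e⟩⟩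
  rintro rfl
  change (x.1 + 1) % m = x.1 at e
  have hx := x.2
  rcases Nat.lt_or_ge (x.1 + 1) m with h1 | h1
  · rw [Nat.mod_eq_of_lt h1] at e
    omega
  · rw [show x.1 + 1 = m by omega, Nat.mod_self] at e
    omega

/-- A graph on more than three vertices in which all distances are at most two and all price ratios
have at most four influential components is a star. -/
theorem exists_center (hm : 3 < m) (hG : G.mechanism.priceComplexity ≤ 4)
    (h2 : ∀ i j, i ≠ j → G.Adj i j ∨ ∃ x, G.Adj i x ∧ G.Adj x j) :
    ∃ c, ∀ i j, (star c).Adj i j ↔ G.Adj i j := by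
  have hout := G.exists_adj (by omega : 1 < m)
  -- Every set of at most three vertices misses some vertex.
  have hfresh : ∀ s : Finset (Fin m), s.card ≤ 3 → ∃ w, w ∉ s := by
    intro s hs
    by_contra! hw
    have := Finset.card_le_card (fun w _ => hw w : (Finset.univ : Finset (Fin m)) ⊆ s)
    rw [Finset.card_univ, Fintype.card_fin] at this
    omega
  have hfresh2 : ∀ x y : Fin m, ∃ u v, u ≠ v ∧ u ≠ x ∧ u ≠ y ∧ v ≠ x ∧ v ≠ y := by
    intro x y
    obtain ⟨u, hu⟩ := hfresh {x, y} (Finset.card_le_two.trans (by norm_num))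
    obtain ⟨v, hv⟩ := hfresh {x, y, u} Finset.card_le_three
    simp only [Finset.mem_insert, Finset.mem_singleton, not_or] at hu hv
    exact ⟨u, v, Ne.symm hv.2.2, hu.1, hu.2, hv.1, hv.2.1⟩
  -- Out-neighbours of a common vertex: if not adjacent, then the first has out-degree one.
  have hsingle : ∀ {k l l' x x'}, l ≠ l' → G.Adj k l → G.Adj k l' → ¬ G.Adj l l' →
      G.Adj l x → G.Adj l x' → x = x' := by
    intro k l l' x x' hl h1 h1' hn hx hx'
    have key : ∀ y, G.Adj l y → G.ReachAvoid l y l' := by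
      intro y hy
      rcases h2 y l' (fun e => hn (e ▸ hy)) with h | ⟨z, hz, hz'⟩
      · exact .single ⟨h, hl.symm⟩
      · exact .head ⟨hz, fun e => hn (e ▸ hz')⟩ (.single ⟨hz', hl.symm⟩)
    exact eq_of_reachAvoid hG hl h1 h1' hx hx' (key x hx) (key x' hx')
  -- The only out-neighbour of a vertex of out-degree one is adjacent to all other vertices.
  have hcone : ∀ {x y v}, G.Adj x y → (∀ z, G.Adj x z → z = y) → v ≠ x → v ≠ y → G.Adj y v := by
    intro x y v _ hu hvx hvy
    rcases h2 x v hvx.symm with h | ⟨z, hz, hz'⟩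
    · exact absurd (hu v h) hvy
    · rwa [← hu z hz]
  by_cases h3 : ∃ k l l' l'', l ≠ l' ∧ l ≠ l'' ∧ l' ≠ l'' ∧ G.Adj k l ∧ G.Adj k l' ∧ G.Adj k l''
  · obtain ⟨k, a, b, c, hab, hac, hbc, ha, hb, hc⟩ := h3
    -- Every out-neighbour `l` of `k` belongs to a triple of distinct out-neighbours.
    have htriple : ∀ l, G.Adj k l → ∃ l' l'', l ≠ l' ∧ l ≠ l'' ∧ l' ≠ l'' ∧ G.Adj k l' ∧
        G.Adj k l'' := by
      intro l _
      by_cases h1 : l = a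
      · exact ⟨b, c, by rwa [h1], by rwa [h1], hbc, hb, hc⟩
      · by_cases h1' : l = b
        · exact ⟨a, c, h1, by rwa [h1'], hac, ha, hc⟩
        · exact ⟨a, b, h1, h1', hab, ha, hb⟩
    have huniq : ∀ l, G.Adj k l → ∀ x x', G.Adj l x → G.Adj l x' → x = x' := by
      intro l hl x x' hx hx'
      obtain ⟨l', l'', n1, n2, n3, hl', hl''⟩ := htriple l hl
      by_cases e1 : G.Adj l l'
      · by_cases e2 : G.Adj l l''
        · exact absurd (eq_of_common_inNeighbors hG n3 hl' hl'' e1 e2) (adj_ne hl)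
        · exact hsingle n2 hl hl'' e2 hx hx'
      · exact hsingle n1 hl hl' e1 hx hx'
    have hback : ∀ l, G.Adj k l → ∀ y, G.Adj l y → y = k := by
      intro l hl y hy
      obtain ⟨l', l'', n1, n2, n3, hl', hl''⟩ := htriple l hl
      have hall : ∀ v, v ≠ l → v ≠ y → G.Adj y v := fun v =>
        hcone hy (fun z hz => huniq l hl z y hz hy)
      by_cases hky : G.Adj k y
      · -- Otherwise `y` would have out-degree one but be adjacent to two vertices.
        obtain ⟨u, v, huv, h1, h2, h3, h4⟩ := hfresh2 l y
        exact absurd (huniq y hky u v (hall u h1 h2) (hall v h3 h4)) huv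
      · exact eq_of_common_inNeighbors hG n3 (hall l' n1.symm fun e => hky (e ▸ hl'))
          (hall l'' n2.symm fun e => hky (e ▸ hl'')) hl' hl''
    have hka : G.Adj a k := by
      obtain ⟨y, hy⟩ := hout a
      rwa [← hback a ha y hy]
    have hall : ∀ v, v ≠ k → G.Adj k v := by
      intro v hv
      by_cases hva : v = a
      · rwa [hva]
      · exact hcone hka (hback a ha) hva hv
    refine ⟨k, fun i j => ⟨?_, fun hij => ⟨adj_ne hij, ?_⟩⟩⟩
    · rintro ⟨hij, rfl | rfl⟩
      · exact hall j hij.symm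
      · obtain ⟨y, hy⟩ := hout i
        rwa [← hback i (hall i hij) y hy]
    · by_cases hi : i = k
      · exact Or.inl hi
      · exact Or.inr (hback i (hall i hi) j hij)
  exfalso
  push Not at h3
  -- The edges `k l`, `k l'`, `l l'` admit no second way from `l` to `l'`.
  have hno : ∀ {k l l' x}, G.Adj k l → G.Adj k l' → G.Adj l l' → G.Adj l x → x ≠ l' →
      ¬ G.ReachAvoid l x l' := fun h1 h1' h h' hx hr =>
    hx (eq_of_reachAvoid hG (adj_ne h) h1 h1' h' h hr .refl)
  by_cases h1 : ∃ x y, G.Adj x y ∧ ∀ z, G.Adj x z → z = y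
  · obtain ⟨x, y, hxy, hx⟩ := h1
    obtain ⟨u, v, huv, hux, huy, hvx, hvy⟩ := hfresh2 x y
    have hyu := hcone hxy hx hux huy
    have hyv := hcone hxy hx hvx hvy
    have hyx : ¬ G.Adj y x := fun h => h3 y u v x huv hux hvx hyu hyv h
    have hV : ∀ w, w = x ∨ w = y ∨ w = u ∨ w = v := by
      intro w
      by_contra! hw
      exact h3 y u v w huv hw.2.2.1.symm hw.2.2.2.symm hyu hyv (hcone hxy hx hw.1 hw.2.1)
    have hadj : G.Adj u v := by
      by_contra hn
      obtain ⟨g, hg⟩ := hout u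
      have hgu : ∀ z, G.Adj u z → z = g := fun z hz => hsingle huv hyu hyv hn hz hg
      rcases hV g with rfl | rfl | rfl | rfl
      · exact hvy (hx v (hcone hg hgu huv.symm hvx))
      · exact hyx (hcone hg hgu hux.symm (adj_ne hxy))
      · exact G.loopless _ hg
      · exact hn hg
    by_cases h4 : ∀ z, G.Adj u z → z = v
    · have hvu : G.Adj v u := by
        by_contra hn
        exact adj_ne hxy (hsingle huv.symm hyv hyu hn (hcone hadj h4 hux.symm hvx.symm)
          (hcone hadj h4 huy.symm hvy.symm))
      exact h3 v x y u (adj_ne hxy) hux.symm huy.symm (hcone hadj h4 hux.symm hvx.symm)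
        (hcone hadj h4 huy.symm hvy.symm) hvu
    · push Not at h4
      obtain ⟨z, hz, hzv⟩ := h4
      refine hno hyu hyv hadj hz hzv ?_
      rcases hV z with rfl | rfl | rfl | rfl
      · exact .head ⟨hxy, huy.symm⟩ (.single ⟨hyv, huv.symm⟩)
      · exact .single ⟨hyv, huv.symm⟩
      · exact absurd hz (G.loopless _)
      · exact absurd rfl hzv
  · push Not at h1
    have hmut : ∀ {k l l'}, l ≠ l' → G.Adj k l → G.Adj k l' → G.Adj l l' := by
      intro k l l' hl hkl hkl'
      by_contra hn
      obtain ⟨y, hy⟩ := hout l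
      obtain ⟨z, hz, hzy⟩ := h1 l y hy
      exact hzy (hsingle hl hkl hkl' hn hz hy)
    obtain ⟨l, hl⟩ := hout ⟨0, by omega⟩
    obtain ⟨l', hl', hne⟩ := h1 _ l hl
    have hll := hmut hne.symm hl hl'
    obtain ⟨x, hx, hxl⟩ := h1 l l' hll
    exact hno hl hl' hll hx hxl (.single ⟨hmut hxl hx hll, hne⟩)

/-! ### Time complexity -/

theorem exists_walk (G : TradeGraph m) {i j : Fin m} (hij : i ≠ j) :
    ∃ v : ℕ → Fin m, v 0 = i ∧ v (G.mechanism.timeComplexityAt i j) = j ∧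
      ∀ t < G.mechanism.timeComplexityAt i j, G.Adj (v t) (v (t + 1)) := by
  suffices h : {k | ∃ v : ℕ → Fin m, v 0 = i ∧ v k = j ∧ ∀ t < k, G.Adj (v t) (v (t + 1))}.Nonempty
    from Nat.sInf_mem h
  have ht := G.connected i j hij
  induction ht using Relation.TransGen.head_induction_on with
  | @single a h =>
    exact ⟨1, fun t => if t = 0 then a else j, by simp, by simp, fun t ht => by
      obtain rfl : t = 0 := by omega
      simpa using h⟩
  | @head a c h _ ih =>
    by_cases hc : c = j
    · subst hc
      exact ⟨1, fun t => if t = 0 then a else c, by simp, by simp, fun t ht => by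
        obtain rfl : t = 0 := by omega
        simpa using h⟩
    obtain ⟨k, v, h0, hk, hv⟩ := ih hc
    refine ⟨k + 1, fun t => t.casesOn a v, rfl, hk, fun t ht => ?_⟩
    cases t with
    | zero =>
      change G.Adj a (v 0)
      rwa [h0]
    | succ t => exact hv t (by omega)

theorem timeComplexityAt_le (v : ℕ → Fin m) (k : ℕ) (hv : ∀ t < k, G.Adj (v t) (v (t + 1))) :
    G.mechanism.timeComplexityAt (v 0) (v k) ≤ k :=
  Nat.sInf_le ⟨v, rfl, rfl, hv⟩

theorem timeComplexityAt_le_timeComplexity {i j : Fin m} (hij : i ≠ j) :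
    G.mechanism.timeComplexityAt i j ≤ G.mechanism.timeComplexity :=
  Finset.le_sup (f := fun e : Fin m × Fin m => G.mechanism.timeComplexityAt e.1 e.2)
    (by simpa using hij : (i, j) ∈ Finset.univ.offDiag)

theorem timeComplexity_le {n : ℕ}
    (h : ∀ i j, i ≠ j → G.mechanism.timeComplexityAt i j ≤ n) :
    G.mechanism.timeComplexity ≤ n :=
  Finset.sup_le fun e he => h e.1 e.2 (by simpa using he)

theorem timeComplexityAt_le_one {i j : Fin m} (h : G.Adj i j) :
    G.mechanism.timeComplexityAt i j ≤ 1 := by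
  simpa using timeComplexityAt_le (G := G) (fun t => if t = 0 then i else j) 1 fun t ht => by
    obtain rfl : t = 0 := by omega
    simpa using h

theorem timeComplexityAt_le_two {i x j : Fin m} (h : G.Adj i x) (h' : G.Adj x j) :
    G.mechanism.timeComplexityAt i j ≤ 2 := by
  simpa using timeComplexityAt_le (G := G)
    (fun t => if t = 0 then i else if t = 1 then x else j) 2 fun t ht => by
      obtain rfl | rfl : t = 0 ∨ t = 1 := by omega
      · simpa using h
      · simpa using h'

theorem timeComplexityAt_pos {i j : Fin m} (hij : i ≠ j) :
    0 < G.mechanism.timeComplexityAt i j := by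
  obtain ⟨v, h0, hk, -⟩ := G.exists_walk hij
  refine Nat.pos_of_ne_zero fun h => hij ?_
  rw [← h0, ← hk, h]

theorem adj_or_exists_of_timeComplexityAt_le_two {i j : Fin m} (hij : i ≠ j)
    (h : G.mechanism.timeComplexityAt i j ≤ 2) : G.Adj i j ∨ ∃ x, G.Adj i x ∧ G.Adj x j := by
  obtain ⟨v, h0, hk, hv⟩ := G.exists_walk hij
  have hpos := timeComplexityAt_pos (G := G) hij
  obtain e | e : G.mechanism.timeComplexityAt i j = 1 ∨ G.mechanism.timeComplexityAt i j = 2 := by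
    omega
  · rw [e] at hk hv
    exact Or.inl (h0 ▸ hk ▸ hv 0 one_pos)
  · rw [e] at hk hv
    exact Or.inr ⟨v 1, h0 ▸ hv 0 two_pos, hk ▸ hv 1 one_lt_two⟩

theorem adj_of_timeComplexityAt_le_one {i j : Fin m} (hij : i ≠ j)
    (h : G.mechanism.timeComplexityAt i j ≤ 1) : G.Adj i j := by
  obtain ⟨v, h0, hk, hv⟩ := G.exists_walk hij
  have hpos := timeComplexityAt_pos (G := G) hij
  rw [show G.mechanism.timeComplexityAt i j = 1 by omega] at hk hv
  exact h0 ▸ hk ▸ hv 0 one_pos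

/-! ### Relabeling -/

/-- `G` and `H` are isomorphic digraphs. -/
def Iso (G H : TradeGraph m) : Prop :=
  ∃ σ : Equiv.Perm (Fin m), ∀ i j, H.Adj (σ i) (σ j) ↔ G.Adj i j

theorem Iso.symm {G H : TradeGraph m} : Iso G H → Iso H G := by
  rintro ⟨σ, h⟩
  exact ⟨σ.symm, fun i j => by rw [← h, σ.apply_symm_apply, σ.apply_symm_apply]⟩

/-- A state transported along an isomorphism of graphs. -/
def Aggregate.map {G H : TradeGraph m} (σ : Equiv.Perm (Fin m))
    (h : ∀ i j, H.Adj (σ i) (σ j) ↔ G.Adj i j) (b : G.Aggregate) : H.Aggregate :=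
  ⟨fun u v => b.1 (σ.symm u) (σ.symm v), fun u v => by
    have := h (σ.symm u) (σ.symm v)
    rw [σ.apply_symm_apply, σ.apply_symm_apply] at this
    rw [this]
    exact b.2 _ _⟩

theorem price_div_price_map {G H : TradeGraph m} (σ : Equiv.Perm (Fin m)) (b : G.Aggregate)
    (b' : H.Aggregate) (hb : ∀ i j, b'.1 (σ i) (σ j) = b.1 i j) (i j : Fin m) :
    H.price b' (σ i) / H.price b' (σ j) = G.price b i / G.price b j := by
  have hp : IsPrice b fun u => H.price b' (σ u) := by
    refine ⟨fun u => (H.price_isPrice b').1 _, fun v => ?_⟩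
    have h := (H.price_isPrice b').2 (σ v)
    rw [← Equiv.sum_comp σ, ← Equiv.sum_comp σ fun u => H.price b' (σ v) * b'.1 (σ v) u] at h
    simpa only [hb] using h
  exact (G.price_div_price b hp i j).symm

theorem isRelabeling_mechanism_iff {G H : TradeGraph m} :
    G.mechanism.IsRelabeling H.mechanism ↔ Iso G H := by
  refine ⟨fun ⟨σ, h, _⟩ => ⟨σ, h⟩, fun ⟨σ, h⟩ => ⟨σ, h, fun b b' hb => ?_⟩⟩
  have hr := price_div_price_map (G := G) (H := H) σ b b' hb
  refine ⟨hr, fun a a' ha j => ?_⟩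
  change ∑ i, H.price b' i / H.price b' (σ j) * a'.1 i (σ j)
    = ∑ i, G.price b i / G.price b j * a.1 i j
  rw [← Equiv.sum_comp σ]
  exact Finset.sum_congr rfl fun i _ => by rw [hr, ha]

theorem Iso.timeComplexity_le {G H : TradeGraph m} (h : Iso G H) :
    G.mechanism.timeComplexity ≤ H.mechanism.timeComplexity := by
  obtain ⟨σ, h⟩ := h
  refine TradeGraph.timeComplexity_le fun i j hij => ?_
  have hne : σ i ≠ σ j := σ.injective.ne hij
  obtain ⟨v, h0, hk, hv⟩ := H.exists_walk hne
  have := timeComplexityAt_le (G := G) (fun t => σ.symm (v t)) _ fun t ht => by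
    have := hv t ht
    rwa [← σ.apply_symm_apply (v t), ← σ.apply_symm_apply (v (t + 1)), h] at this
  simp only [h0, hk, σ.symm_apply_apply] at this
  exact this.trans (timeComplexityAt_le_timeComplexity hne)

theorem priceComplexity_le {n : ℕ}
    (h : ∀ i j, i ≠ j → G.mechanism.priceComplexityAt i j ≤ n) :
    G.mechanism.priceComplexity ≤ n :=
  Finset.sup_le fun e he => h e.1 e.2 (by simpa using he)

theorem Iso.priceComplexity_le {G H : TradeGraph m} (h : Iso G H) :
    G.mechanism.priceComplexity ≤ H.mechanism.priceComplexity := by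
  classical
  obtain ⟨σ, h⟩ := h
  refine TradeGraph.priceComplexity_le fun i j hij => ?_
  let s : Finset (Fin m × Fin m) := Set.Finite.toFinset
    (Set.toFinite {e | Mechanism.Influential (G.mechanism.priceRatio i j) e.1 e.2})
  have hs : s.card = G.mechanism.priceComplexityAt i j :=
    (Set.ncard_eq_toFinset_card _ _).symm
  rw [← hs, ← Finset.card_map (σ.prodCongr σ).toEmbedding]
  refine H.card_le_priceComplexity (σ.injective.ne hij) _ fun e he => ?_
  obtain ⟨⟨k, l⟩, hkl, rfl⟩ := Finset.mem_map.1 he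
  obtain ⟨b, b', hb, hne⟩ := (Set.Finite.mem_toFinset _).1 hkl
  refine ⟨b.map σ h, b'.map σ h, fun u v huv => hb _ _ fun e => huv ?_, ?_⟩
  · rw [Prod.ext_iff] at e ⊢
    exact ⟨σ.symm_apply_eq.1 e.1, σ.symm_apply_eq.1 e.2⟩
  · have hm : ∀ c : G.Aggregate, H.mechanism.priceRatio (σ i) (σ j) (c.map σ h)
        = G.mechanism.priceRatio i j c := fun c =>
      price_div_price_map σ c (c.map σ h) (fun u v => by simp [Aggregate.map]) i j
    exact fun e => hne ((hm b).symm.trans (e.trans (hm b')))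

theorem Iso.timeComplexity_eq {G H : TradeGraph m} (h : Iso G H) :
    G.mechanism.timeComplexity = H.mechanism.timeComplexity :=
  le_antisymm h.timeComplexity_le h.symm.timeComplexity_le

theorem Iso.priceComplexity_eq {G H : TradeGraph m} (h : Iso G H) :
    G.mechanism.priceComplexity = H.mechanism.priceComplexity :=
  le_antisymm h.priceComplexity_le h.symm.priceComplexity_le

theorem star_iso_star (c c' : Fin m) : Iso (star c) (star c') := by
  refine ⟨Equiv.swap c c', fun i j => ?_⟩
  have : ∀ x, Equiv.swap c c' x = c' ↔ x = c := fun x => by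
    rw [Equiv.swap_apply_eq_iff, Equiv.swap_apply_right]
  change _ ≠ _ ∧ (_ ∨ _) ↔ _ ≠ _ ∧ (_ ∨ _)
  rw [this, this, (Equiv.injective _).ne_iff]

/-! ### Complexities of the star, the cycle and the complete mechanism -/

theorem priceComplexityAt_le_card {i j : Fin m} (s : Finset (Fin m × Fin m))
    (h : ∀ k l, Mechanism.Influential (G.mechanism.priceRatio i j) k l → (k, l) ∈ s) :
    G.mechanism.priceComplexityAt i j ≤ s.card := by
  rw [← Set.ncard_coe_finset]
  exact Set.ncard_le_ncard (fun e he => h e.1 e.2 he) (Set.toFinite _)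

theorem timeComplexity_star (c : Fin m) (hm : 2 < m) :
    (star c).mechanism.timeComplexity = 2 := by
  apply le_antisymm
  · refine timeComplexity_le fun i j hij => ?_
    by_cases hi : i = c
    · exact (timeComplexityAt_le_one (G := star c) ⟨hij, Or.inl hi⟩).trans one_le_two
    by_cases hj : j = c
    · exact (timeComplexityAt_le_one (G := star c) ⟨hij, Or.inr hj⟩).trans one_le_two
    exact timeComplexityAt_le_two (G := star c) (x := c) ⟨hi, Or.inr rfl⟩ ⟨Ne.symm hj, Or.inl rfl⟩
  · obtain ⟨i, j, hi, hj, hij⟩ : ∃ i j, i ≠ c ∧ j ≠ c ∧ i ≠ j := by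
      have : 1 < (Finset.univ.erase c).card := by
        rw [Finset.card_erase_of_mem (Finset.mem_univ _), Finset.card_univ, Fintype.card_fin]
        omega
      obtain ⟨i, hi, j, hj, hij⟩ := Finset.one_lt_card.1 this
      exact ⟨i, j, Finset.ne_of_mem_erase hi, Finset.ne_of_mem_erase hj, hij⟩
    refine le_trans ?_ (timeComplexityAt_le_timeComplexity hij)
    by_contra h
    have := adj_of_timeComplexityAt_le_one (G := star c) hij (by omega)
    exact this.2.elim hi hj

theorem price_star {c i : Fin m} (b : (star c).Aggregate) (hi : i ≠ c) :
    (star c).price b i / (star c).price b c = b.1 c i / b.1 i c := by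
  have hp := (star c).price_isPrice b
  have h := hp.2 i
  rw [Finset.sum_eq_single c, Finset.sum_eq_single c] at h
  · have h1 := (hp.1 c).ne'
    have h2 := ((b.2 i c).1 ⟨hi, Or.inr rfl⟩).ne'
    field_simp
    linarith
  · intro u _ hu
    rw [(b.2 i u).2 fun h => h.2.elim hi hu, mul_zero]
  · simp
  · intro u _ hu
    rw [(b.2 u i).2 fun h => h.2.elim hu hi, mul_zero]
  · simp

theorem priceComplexity_star (c : Fin m) (hm : 2 < m) :
    (star c).mechanism.priceComplexity = 4 := by
  classical
  apply le_antisymm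
  · refine priceComplexity_le fun i j _ => ?_
    refine (priceComplexityAt_le_card {(c, i), (i, c), (c, j), (j, c)} fun k l hkl => ?_).trans
      Finset.card_le_four
    by_contra hn
    simp only [Finset.mem_insert, Finset.mem_singleton, not_or] at hn
    obtain ⟨b, b', hb, hne⟩ := hkl
    have key : ∀ x, (c, x) ≠ (k, l) → (x, c) ≠ (k, l) →
        (star c).price b x / (star c).price b c = (star c).price b' x / (star c).price b' c := by
      intro x h1 h2
      by_cases hx : x = c
      · rw [hx, div_self (((star c).price_isPrice b).1 c).ne',
          div_self (((star c).price_isPrice b').1 c).ne']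
      · rw [price_star b hx, price_star b' hx, hb _ _ h1, hb _ _ h2]
    apply hne
    change (star c).price b i / (star c).price b j = (star c).price b' i / (star c).price b' j
    rw [← div_div_div_cancel_right₀ (((star c).price_isPrice b).1 c).ne' _ ((star c).price b j),
      ← div_div_div_cancel_right₀ (((star c).price_isPrice b').1 c).ne' _ ((star c).price b' j),
      key i (Ne.symm hn.1) (Ne.symm hn.2.1), key j (Ne.symm hn.2.2.1) (Ne.symm hn.2.2.2)]
  · have : 1 < (Finset.univ.erase c).card := by
      rw [Finset.card_erase_of_mem (Finset.mem_univ _), Finset.card_univ, Fintype.card_fin]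
      omega
    obtain ⟨i, hi, j, hj, hij⟩ := Finset.one_lt_card.1 this
    exact four_le_priceComplexity (G := star c) (k := c)
      ⟨(Finset.ne_of_mem_erase hi).symm, Or.inl rfl⟩
      ⟨(Finset.ne_of_mem_erase hj).symm, Or.inl rfl⟩ hij

theorem cycle_adj_iff (hm : 1 < m) (i j : Fin m) :
    (cycle m).Adj i j ↔ (i.val + 1) % m = j.val := by
  refine ⟨fun h => h.2, fun h => ⟨?_, h⟩⟩
  rintro rfl
  rcases Nat.lt_or_ge (i.1 + 1) m with h1 | h1
  · rw [Nat.mod_eq_of_lt h1] at h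
    omega
  · rw [show i.1 + 1 = m by have := i.2; omega, Nat.mod_self] at h
    omega

theorem timeComplexity_cycle (hm : 1 < m) :
    (cycle m).mechanism.timeComplexity = m - 1 := by
  apply le_antisymm
  · refine timeComplexity_le fun i j hij => ?_
    let n := (j.1 + m - i.1) % m
    have hn : n < m := Nat.mod_lt _ (by omega)
    let v : ℕ → Fin m := fun t => ⟨(i.1 + t) % m, Nat.mod_lt _ (by omega)⟩
    have h := timeComplexityAt_le (G := cycle m) v n fun t _ => by
      rw [cycle_adj_iff hm]
      simp only [v, Nat.mod_add_mod, Nat.add_assoc]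
    have h0 : v 0 = i := Fin.ext (by simp [v, Nat.mod_eq_of_lt i.2])
    have hk : v n = j := Fin.ext (by
      simp only [v, n, Nat.add_mod_mod]
      rw [show i.1 + (j.1 + m - i.1) = j.1 + m by omega, Nat.add_mod_right,
        Nat.mod_eq_of_lt j.2])
    rw [h0, hk] at h
    omega
  · have hne : (⟨0, by omega⟩ : Fin m) ≠ ⟨m - 1, by omega⟩ := by
      rw [Ne, Fin.mk.injEq]
      omega
    refine le_trans ?_ (timeComplexityAt_le_timeComplexity hne)
    obtain ⟨v, h0, hk, hv⟩ := (cycle m).exists_walk hne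
    have key : ∀ t ≤ (cycle m).mechanism.timeComplexityAt ⟨0, by omega⟩ ⟨m - 1, by omega⟩,
        (v t).1 ≤ t := by
      intro t
      induction t with
      | zero =>
        intro _
        rw [h0]
      | succ t ih =>
        intro ht
        rw [← (hv t ht).2]
        exact (Nat.mod_le _ _).trans (Nat.succ_le_succ (ih (by omega)))
    have := key _ le_rfl
    rwa [hk] at this

/-- In the cycle, the value of the offers of a commodity is the same for all commodities. -/
theorem exists_price_mul_eq (hm : 1 < m) (b : (cycle m).Aggregate) :
    ∃ w : ℝ, 0 < w ∧ ∀ i, (cycle m).price b i * ∑ u, b.1 i u = w := by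
  have hp := (cycle m).price_isPrice b
  have hstep : ∀ i j, (cycle m).Adj i j →
      (cycle m).price b j * ∑ u, b.1 j u = (cycle m).price b i * ∑ u, b.1 i u := by
    intro i j hij
    have h := hp.2 j
    rw [Finset.sum_eq_single i, ← Finset.mul_sum] at h
    · rw [← h, Finset.sum_eq_single j]
      · intro u _ hu
        refine (b.2 i u).2 fun h => hu (Fin.ext ?_)
        rw [← h.2, ← hij.2]
      · simp
    · intro u _ hu
      rw [(b.2 u j).2, mul_zero]
      intro h
      refine hu (Fin.ext ?_)
      have e : u.1 + 1 ≡ i.1 + 1 [MOD m] := h.2.trans hij.2.symm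
      exact (Nat.ModEq.add_right_cancel' 1 e).eq_of_lt_of_lt u.2 i.2
    · simp
  let a : Fin m := ⟨0, by omega⟩
  obtain ⟨z, hz⟩ := (cycle m).exists_adj hm a
  refine ⟨(cycle m).price b a * ∑ u, b.1 a u, mul_pos (hp.1 a) ?_, fun i => ?_⟩
  · exact Finset.sum_pos' (fun u _ => b.nonneg a u) ⟨z, Finset.mem_univ z, (b.2 a z).1 hz⟩
  · by_cases hi : a = i
    · rw [hi]
    · have ht := (cycle m).connected a i hi
      clear hi
      induction ht with
      | single h => exact hstep _ _ h
      | tail _ h ih => rw [hstep _ _ h, ih]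

theorem priceComplexity_cycle (hm : 1 < m) :
    (cycle m).mechanism.priceComplexity = 2 := by
  classical
  apply le_antisymm
  · refine priceComplexity_le fun i j _ => ?_
    obtain ⟨x, hx⟩ := (cycle m).exists_adj hm i
    obtain ⟨y, hy⟩ := (cycle m).exists_adj hm j
    refine (priceComplexityAt_le_card {(i, x), (j, y)} fun k l hkl => ?_).trans
      Finset.card_le_two
    by_contra hn
    simp only [Finset.mem_insert, Finset.mem_singleton, not_or] at hn
    have hadj := adj_of_influential hkl
    have hki : k ≠ i := by
      rintro rfl
      exact hn.1 (by rw [Prod.mk.injEq]; exact ⟨rfl, Fin.ext (hadj.2.symm.trans hx.2)⟩)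
    have hkj : k ≠ j := by
      rintro rfl
      exact hn.2 (by rw [Prod.mk.injEq]; exact ⟨rfl, Fin.ext (hadj.2.symm.trans hy.2)⟩)
    obtain ⟨b, b', hb, hne⟩ := hkl
    have hsum : ∀ u, k ≠ u → ∑ v, b.1 u v = ∑ v, b'.1 u v := fun u hu =>
      Finset.sum_congr rfl fun v _ => hb u v fun e => hu (Prod.ext_iff.1 e).1.symm
    have key : ∀ c : (cycle m).Aggregate, (cycle m).price c i / (cycle m).price c j
        = (∑ u, c.1 j u) / ∑ u, c.1 i u := by
      intro c
      obtain ⟨w, hw, h⟩ := exists_price_mul_eq hm c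
      have h1 := (((cycle m).price_isPrice c).1 j).ne'
      have h2 : ∑ u, c.1 i u ≠ 0 := fun e => by
        have := h i
        rw [e, mul_zero] at this
        exact hw.ne this
      rw [div_eq_div_iff h1 h2, h i, mul_comm, h j]
    refine hne ((key b).trans (Eq.trans ?_ (key b').symm))
    rw [hsum i hki, hsum j hkj]
  · exact two_le_priceComplexity (i := ⟨0, by omega⟩) (j := ⟨1, hm⟩) (by
      rw [Ne, Fin.mk.injEq]; omega)

theorem timeComplexity_complete (hm : 1 < m) :
    (complete m).mechanism.timeComplexity = 1 := by
  apply le_antisymm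
  · exact timeComplexity_le fun _ _ hij => timeComplexityAt_le_one (G := complete m) hij
  · have hne : (⟨0, by omega⟩ : Fin m) ≠ ⟨1, hm⟩ := by
      rw [Ne, Fin.mk.injEq]
      omega
    exact (timeComplexityAt_pos hne).trans_le (timeComplexityAt_le_timeComplexity hne)

/-- In the complete graph, an edge disjoint from `{i, j}` influences the price ratio of `i` and
`j`. At the fully symmetric state an increase of `b k l` may move `p i` and `p j` alike, so the
state used has doubled offers between `k` and `j`. -/
theorem influential_complete_of_ne {i j k l : Fin m} (hkl : k ≠ l) (hij : i ≠ j) (hki : k ≠ i)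
    (hkj : k ≠ j) (hli : l ≠ i) (hlj : l ≠ j) :
    Mechanism.Influential ((complete m).mechanism.priceRatio i j) k l := by
  let w : Fin m → Fin m → ℝ := fun u v =>
    if u = v then 0 else 1 + if (u = k ∧ v = j) ∨ (u = j ∧ v = k) then 1 else 0
  let b : (complete m).Aggregate := ⟨w, fun u v => by
    refine ⟨fun h => ?_, fun h => if_pos (not_not.1 h)⟩
    simp only [w, if_neg (show u ≠ v from h)]
    split_ifs <;> norm_num⟩
  have hsymm : ∀ u v, w u v = w v u := fun u v => by
    simp only [w, eq_comm (a := u) (b := v), and_comm, or_comm]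
  have hp : IsPrice b fun _ => 1 :=
    ⟨fun _ => one_pos, fun v => Finset.sum_congr rfl fun u _ => by
      change 1 * w u v = 1 * w v u
      rw [hsymm]⟩
  have h : (complete m).Adj k l := hkl
  have hp' := (complete m).price_isPrice (b.bump h)
  set q := (complete m).price (b.bump h)
  refine influential_of_ratio_ne h hp hp' ?_
  have hlt : q k < q j := by
    simpa using ratio_source_lt hp hp' (j := j) (.single ⟨hlj, hkj.symm⟩)
  have ei := sum_mul_ratio_sub hp hp' i
  have ej := sum_mul_ratio_sub hp hp' j
  simp only [if_neg hki.symm, if_neg hli.symm, if_neg hkj.symm, if_neg hlj.symm, sub_zero, div_one,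
    one_mul] at ei ej
  have ei' : ∑ u, (q u - q i) = 0 := by
    rw [← ei]
    refine Finset.sum_congr rfl fun u _ => ?_
    change _ = w u i * _
    by_cases hu : u = i
    · simp [hu]
    · simp [w, hu, hij, hki.symm]
  have ej' : ∑ u, (q u - q j) + (q k - q j) = 0 := by
    have : ∑ u, (if u = k then q u - q j else 0) = q k - q j := by simp
    rw [← ej, ← this, ← Finset.sum_add_distrib]
    refine Finset.sum_congr rfl fun u _ => ?_
    change _ = w u j * _
    by_cases hu : u = j
    · simp [hu]
    · by_cases huk : u = k
      · simp [w, huk, hkj]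
        ring
      · simp [w, hu, huk]
  simp only [div_one]
  intro e
  rw [e] at ei'
  linarith

theorem priceComplexity_complete (hm : 1 < m) :
    (complete m).mechanism.priceComplexity = m * (m - 1) := by
  classical
  have hcard : (Finset.univ : Finset (Fin m)).offDiag.card = m * (m - 1) := by
    rw [Finset.offDiag_card, Finset.card_univ, Fintype.card_fin, Nat.mul_sub_one]
  rw [← hcard]
  apply le_antisymm
  · refine priceComplexity_le fun i j _ => priceComplexityAt_le_card _ fun k l hkl => ?_
    simpa using adj_ne (adj_of_influential hkl)
  · have hij : (⟨0, by omega⟩ : Fin m) ≠ ⟨1, hm⟩ := by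
      rw [Ne, Fin.mk.injEq]
      omega
    refine card_le_priceComplexity _ hij _ ?_
    generalize (⟨0, by omega⟩ : Fin m) = i at hij
    generalize (⟨1, hm⟩ : Fin m) = j at hij
    rintro ⟨k, l⟩ hkl
    replace hkl : k ≠ l := by simpa using hkl
    have hadj : (complete m).Adj k l := hkl
    have hreach : ∀ x, x ≠ k → (complete m).ReachAvoid k l x := fun x hx => by
      by_cases hlx : l = x
      · rw [hlx]
        exact .refl
      · exact .single ⟨hlx, hx⟩
    by_cases hki : k = i
    · subst hki
      exact (influential_out hadj (hreach j hij.symm)).1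
    by_cases hkj : k = j
    · subst hkj
      exact (influential_out hadj (hreach i hij)).2
    by_cases hli : l = i
    · subst hli
      exact (influential_fork hadj (show (complete m).Adj k j from hkj) hij.symm).1
    by_cases hlj : l = j
    · subst hlj
      exact (influential_fork hadj (show (complete m).Adj k i from hki) hij).2
    exact influential_complete_of_ne hkl hij hki hkj hli hlj

/-! ### Minimal mechanisms -/

theorem iso_complete_of_timeComplexity_le_one (h : G.mechanism.timeComplexity ≤ 1) :
    Iso G (complete m) :=
  ⟨Equiv.refl _, fun _ _ => ⟨fun hij => adj_of_timeComplexityAt_le_one hij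
    ((timeComplexityAt_le_timeComplexity hij).trans h), adj_ne⟩⟩

theorem iso_cycle_of_priceComplexity_lt_four (hm : 1 < m)
    (h : G.mechanism.priceComplexity < 4) : Iso G (cycle m) :=
  G.exists_perm_cycle hm fun k l l' hl hl' => by
    by_contra hne
    exact absurd (four_le_priceComplexity hl hl' hne) (by omega)

theorem iso_star_of_complexity_le (hm : 3 < m) (h4 : G.mechanism.priceComplexity ≤ 4)
    (h2 : G.mechanism.timeComplexity ≤ 2) (c : Fin m) : Iso G (star c) := by
  obtain ⟨c', hc'⟩ := exists_center hm h4 fun i j hij =>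
    adj_or_exists_of_timeComplexityAt_le_two hij
      ((timeComplexityAt_le_timeComplexity hij).trans h2)
  have h : Iso (star c') (star c) := star_iso_star c' c
  obtain ⟨σ, hσ⟩ := h
  exact ⟨σ, fun i j => (hσ i j).trans (hc' i j)⟩

theorem isMinimal_mechanism_iff :
    G.mechanism.IsMinimal ↔ ∀ H : TradeGraph m,
      H.mechanism.timeComplexity ≤ G.mechanism.timeComplexity →
      H.mechanism.priceComplexity ≤ G.mechanism.priceComplexity →
      G.mechanism.timeComplexity ≤ H.mechanism.timeComplexity ∧
        G.mechanism.priceComplexity ≤ H.mechanism.priceComplexity := by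
  constructor
  · rintro ⟨-, h⟩ H h1 h2
    by_contra hn
    exact h ⟨_, ⟨H, rfl⟩, ⟨h1, h2⟩, by omega⟩
  · rintro h
    refine ⟨⟨G, rfl⟩, ?_⟩
    rintro ⟨_, ⟨H, rfl⟩, ⟨h1, h2⟩, h3⟩
    have := h H h1 h2
    omega

theorem isMinimal_iff_iso (hm : 3 < m) (c : Fin m) :
    G.mechanism.IsMinimal ↔ Iso G (star c) ∨ Iso G (cycle m) ∨ Iso G (complete m) := by
  have s1 := timeComplexity_star c (by omega)
  have s2 := priceComplexity_star c (by omega)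
  have c1 := timeComplexity_cycle (m := m) (by omega)
  have c2 := priceComplexity_cycle (m := m) (by omega)
  have k1 := timeComplexity_complete (m := m) (by omega)
  have k2 := priceComplexity_complete (m := m) (by omega)
  have hk : 4 < m * (m - 1) := lt_of_lt_of_le (by norm_num : 4 < 4 * 3)
    (Nat.mul_le_mul (by omega) (by omega))
  rw [isMinimal_mechanism_iff]
  constructor
  · intro h
    by_cases ht : G.mechanism.timeComplexity ≤ 1
    · exact Or.inr (Or.inr (iso_complete_of_timeComplexity_le_one ht))
    by_cases hp : G.mechanism.priceComplexity < 4
    · exact Or.inr (Or.inl (iso_cycle_of_priceComplexity_lt_four (by omega) hp))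
    have := h (star c) (by omega) (by omega)
    exact Or.inl (iso_star_of_complexity_le hm (by omega) (by omega) c)
  · rintro (h | h | h) H h1 h2 <;> rw [h.timeComplexity_eq] at h1 ⊢ <;>
      rw [h.priceComplexity_eq] at h2 ⊢
    · have hH := iso_star_of_complexity_le hm (by omega) (by omega) c (G := H)
      exact ⟨hH.timeComplexity_eq.ge, hH.priceComplexity_eq.ge⟩
    · have hH := iso_cycle_of_priceComplexity_lt_four (by omega) (by omega) (G := H)
      exact ⟨hH.timeComplexity_eq.ge, hH.priceComplexity_eq.ge⟩
    · have hH := iso_complete_of_timeComplexity_le_one (by omega) (G := H)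
      exact ⟨hH.timeComplexity_eq.ge, hH.priceComplexity_eq.ge⟩

end TradeGraph

open TradeGraph

theorem theorem1 (m : ℕ) (hm : 3 < m) :
    (∀ M ∈ gMechanisms m, M.IsMinimal ↔
      M.IsRelabeling (starMechanism m (by omega)) ∨ M.IsRelabeling (cycleMechanism m) ∨
        M.IsRelabeling (completeMechanism m)) ∧
    (¬ (starMechanism m (by omega)).IsRelabeling (cycleMechanism m) ∧
      ¬ (starMechanism m (by omega)).IsRelabeling (completeMechanism m) ∧
      ¬ (cycleMechanism m).IsRelabeling (completeMechanism m)) ∧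
    ((starMechanism m (by omega)).priceComplexity = 4 ∧ (starMechanism m (by omega)).timeComplexity = 2) ∧
    ((cycleMechanism m).priceComplexity = 2 ∧ (cycleMechanism m).timeComplexity = m - 1) ∧
    ((completeMechanism m).priceComplexity = m * (m - 1) ∧
      (completeMechanism m).timeComplexity = 1) := by
  simp only [starMechanism, cycleMechanism, completeMechanism]
  generalize (⟨m - 1, _⟩ : Fin m) = c
  have s1 := timeComplexity_star c (by omega)
  have c1 := timeComplexity_cycle (m := m) (by omega)
  have k1 := timeComplexity_complete (m := m) (by omega)
  refine ⟨?_, ⟨fun h => ?_, fun h => ?_, fun h => ?_⟩, ⟨priceComplexity_star c (by omega), s1⟩,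
    ⟨priceComplexity_cycle (by omega), c1⟩, priceComplexity_complete (by omega), k1⟩
  · rintro _ ⟨G, rfl⟩
    rw [isRelabeling_mechanism_iff, isRelabeling_mechanism_iff, isRelabeling_mechanism_iff]
    exact isMinimal_iff_iso hm c
  all_goals
    have := (isRelabeling_mechanism_iff.1 h).timeComplexity_eq
    omega
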